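/- Let $n\ge 1$ be odd and let $D\subset\mathbb R^n$ be a bounded domain (nonempty, open, connected) with $C^\infty$ boundary. For $\omega\in S^{n-1}$ and $t\in\mathbb R$ let $V_D(\omega,t)$ be the $(n-1)$-dimensional volume of the section $D\cap\{x\in\mathbb R^n:\langle\omega,x\rangle=t\}$. Suppose that for almost every $\omega\in S^{n-1}$ (with respect to surface measure) there is a real polynomial $p_\omega$ of degree at most $n-1$ such that $V_D(\omega,t)=p_\omega(t)$ for every $t$ for which the hyperplane $\{x:\langle\omega,x\rangle=t\}$ meets $D$. Then $D$ is an ellipsoid, that is, there are a point $c\in\mathbb R^n$, an orthonormal basis $b_1,\dots,b_n$ of $\mathbb R^n$ and numbers $a_1,\dots,a_n>0$ such that $$D=\Big\{x\in\mathbb R^n:\ \sum_{j=1}^n \frac{\langle x-c,b_j\rangle^2}{a_j^2}<1\Big\}.$$ -/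

import Mathlib

open MeasureTheory

/-- A domain: a nonempty connected open subset of `ℝⁿ`. -/
def IsDomainSet {n : ℕ} (D : Set (EuclideanSpace ℝ (Fin n))) : Prop :=
  IsOpen D ∧ IsConnected D

/-- `D` has a `C^∞` boundary: near each boundary point, `D` is the sublevel set `{ρ < 0}` of a
`C^∞` function `ρ` whose differential does not vanish. -/
def HasSmoothBoundary {n : ℕ} (D : Set (EuclideanSpace ℝ (Fin n))) : Prop :=
  ∀ p ∈ frontier D, ∃ U : Set (EuclideanSpace ℝ (Fin n)), IsOpen U ∧ p ∈ U ∧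
    ∃ ρ : EuclideanSpace ℝ (Fin n) → ℝ, ContDiffOn ℝ (⊤ : ℕ∞) ρ U ∧
      (∀ x ∈ U, fderiv ℝ ρ x ≠ 0) ∧ D ∩ U = {x ∈ U | ρ x < 0}

/-- The hyperplane `{x : ⟨ω, x⟩ = t}`. -/
def hyperplane {n : ℕ} (ω : Metric.sphere (0 : EuclideanSpace ℝ (Fin n)) 1) (t : ℝ) :
    Set (EuclideanSpace ℝ (Fin n)) :=
  {x | inner ℝ (ω : EuclideanSpace ℝ (Fin n)) x = t}

/-- The section-volume function `V_D(ω, t)`: the `(n-1)`-dimensional Euclidean volume of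
`D ∩ {x : ⟨ω, x⟩ = t}`, where `μHE[n - 1]` is the Hausdorff measure normalised so that it is
Lebesgue measure on `(n-1)`-dimensional Euclidean spaces. -/
noncomputable def sectionVolume {n : ℕ} (D : Set (EuclideanSpace ℝ (Fin n)))
    (ω : Metric.sphere (0 : EuclideanSpace ℝ (Fin n)) 1) (t : ℝ) : ℝ :=
  μHE[n - 1].real (D ∩ hyperplane ω t)

/-- `D` is a (solid, open) ellipsoid: with respect to some centre `c`, some orthonormal basis
`b` and some semi-axes `a j > 0`, it is the set `∑ (x_j / a_j)² < 1`. -/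
def IsEllipsoid {n : ℕ} (D : Set (EuclideanSpace ℝ (Fin n))) : Prop :=
  ∃ (c : EuclideanSpace ℝ (Fin n))
    (b : OrthonormalBasis (Fin n) ℝ (EuclideanSpace ℝ (Fin n))) (a : Fin n → ℝ),
    (∀ j, 0 < a j) ∧ D = {x | ∑ j, (inner ℝ (b j) (x - c) / a j) ^ 2 < 1}

/-! Why the theorem is true. Write `n = 2m + 1` and let `h` be the support function of `D`.

*Order of vanishing.* A convex function has a quadratic upper bound around almost every point
(`ae_exists_le_add_sq`): along lines this is the almost everywhere differentiability of monotone
functions, and convexity spreads the bound from the coordinate axes to a neighbourhood. Applied to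
`h`, this says that for almost every direction `ω` the set `D` lies in a paraboloid with apex at its
extreme point (`ae_toSphere_hasParabolicSupport`). The section at depth `ε` below the supporting
hyperplane then has diameter `O(√ε)` and volume `O(εᵐ)`. So the polynomial `p_ω` vanishes to order
`m` at both ends of the interval `(a, b)` of heights that meet `D`; as its degree is at most `2m`,
it equals `A (b - t)ᵐ (t - a)ᵐ` (`exists_section_volume_eq_bumpDensity`).

*Marginals.* By Fubini, the marginal in direction `ω` of the uniform distribution on `D` is the
affine image `c(ω) + r(ω) s` of one fixed law, with density proportional to `(1 - s²)ᵐ` on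
`(-1, 1)`. The marginals of the uniform distribution on the unit ball are this law itself. Comparing
means and variances, `c(ω)` is the inner product of `ω` with the centroid and `r(ω)²` is a positive
definite quadratic form. Diagonalising this form yields an affine image of the unit ball with the
same marginals, hence with the same characteristic function, as `D`
(`exists_eq_map_add_diagonalMap`).

*Conclusion.* The uniform distributions on `D` and on the interior of an ellipsoid coincide, so `D`
is contained in the ellipsoid and dense in it. The boundary regularity enters only here: it excludes
that `D` is the ellipsoid with a closed null set removed
(`interior_closure_subset_of_hasSmoothBoundary`). -/

open Filter Topology Set

/-! ### Second-order upper bounds for convex functions -/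


/-- A monotone function on the line grows at most linearly around almost every point. The constant
and the size of the neighbourhood are encoded by one natural number. -/
lemma Monotone.ae_exists_sub_le {φ : ℝ → ℝ} (hφ : Monotone φ) :
    ∀ᵐ s, ∃ k : ℕ, ∀ u : ℝ, |u| ≤ 1 / (k + 1) → φ (s + |u|) - φ (s - |u|) ≤ k * |u| := by
  filter_upwards [hφ.ae_differentiableAt] with s hs
  have hO := hs.hasDerivAt.isBigO_sub
  obtain ⟨C, hC⟩ := hO.bound
  obtain ⟨δ, hδ, hball⟩ := Metric.eventually_nhds_iff.1 hC
  obtain ⟨k₁, hk₁⟩ := exists_nat_one_div_lt hδ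
  obtain ⟨k₂, hk₂⟩ := exists_nat_ge (2 * C)
  refine ⟨max k₁ k₂, fun u hu => ?_⟩
  have h1 : |u| < δ := by
    refine lt_of_le_of_lt (hu.trans ?_) hk₁
    gcongr
    exact_mod_cast le_max_left _ _
  have hp := hball (y := s + |u|) (by simpa [Real.dist_eq] using h1)
  have hm := hball (y := s - |u|) (by simpa [Real.dist_eq] using h1)
  simp only [Real.norm_eq_abs, add_sub_cancel_left, abs_abs, sub_sub_cancel_left, abs_neg] at hp hm
  have h2 : 2 * C ≤ ((max k₁ k₂ : ℕ) : ℝ) := hk₂.trans (by exact_mod_cast le_max_right _ _)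
  have h3 := mul_le_mul_of_nonneg_right h2 (abs_nonneg u)
  linarith [abs_le.1 hp, abs_le.1 hm]

/-- A function on the line with a subgradient `φ s` at every `s` has, at almost every point,
a bounded symmetric second difference quotient. -/
lemma ae_exists_second_difference_le {g φ : ℝ → ℝ} (h : ∀ s t, g s + φ s * (t - s) ≤ g t) :
    ∀ᵐ s, ∃ k : ℕ, ∀ u : ℝ, |u| ≤ 1 / (k + 1) →
      g (s + u) + g (s - u) - 2 * g s ≤ k * u ^ 2 := by
  have hφ : Monotone φ := by
    intro s t hst
    rcases hst.eq_or_lt with rfl | hlt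
    · rfl
    have h1 := h s t
    have h2 := h t s
    by_contra! hcon
    nlinarith
  filter_upwards [hφ.ae_exists_sub_le] with s ⟨k, hk⟩
  refine ⟨k, fun u hu => ?_⟩
  have key : g (s + u) + g (s - u) = g (s + |u|) + g (s - |u|) := by
    rcases abs_choice u with h | h <;> rw [h]
    rw [sub_neg_eq_add, ← sub_eq_add_neg, add_comm]
  have h1 := h (s + |u|) s
  have h2 := h (s - |u|) s
  have h3 := mul_le_mul_of_nonneg_right (hk u hu) (abs_nonneg u)
  rw [key, ← sq_abs u]
  nlinarith

section

variable {E : Type*} [NormedAddCommGroup E] [InnerProductSpace ℝ E] [FiniteDimensional ℝ E]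
  [MeasurableSpace E] [BorelSpace E]

/-- Fubini turns the one-dimensional bound on second differences into a bound in a fixed
direction `e` at almost every point. -/
lemma ae_exists_second_difference_le_of_direction {f : E → ℝ} {P : E → E} (hf : Continuous f)
    (hP : ∀ x y, f x + inner ℝ (P x) (y - x) ≤ f y) (e : E) :
    ∀ᵐ x : E, ∃ k : ℕ, ∀ u : ℝ, |u| ≤ 1 / (k + 1) →
      f (x + u • e) + f (x - u • e) - 2 * f x ≤ k * u ^ 2 := by
  set S : Set E := ⋃ k : ℕ, {x | ∀ u : ℝ, |u| ≤ 1 / (k + 1) →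
      f (x + u • e) + f (x - u • e) - 2 * f x ≤ k * u ^ 2} with hS
  have hmeas : MeasurableSet S := by
    refine MeasurableSet.iUnion fun k => IsClosed.measurableSet ?_
    simp only [ofPred_forall]
    exact isClosed_iInter fun u => isClosed_iInter fun _ =>
      isClosed_le (by fun_prop) continuous_const
  have key : ∀ᵐ x : E, x ∈ S := by
    refine ae_mem_of_ae_add_linearMap_mem (LinearMap.toSpanSingleton ℝ E e) (volume : Measure ℝ)
      (volume : Measure E) hmeas fun y => ?_
    have := ae_exists_second_difference_le (g := fun s => f (y + s • e))
      (φ := fun s => inner ℝ (P (y + s • e)) e) (fun s t => by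
        have := hP (y + s • e) (y + t • e)
        rwa [add_sub_add_left_eq_sub, ← sub_smul, real_inner_smul_right, mul_comm] at this)
    filter_upwards [this] with s ⟨k, hk⟩
    refine mem_iUnion.2 ⟨k, fun u hu => ?_⟩
    have := hk u hu
    simpa [LinearMap.toSpanSingleton_apply, add_smul, sub_smul, add_assoc, add_sub_assoc] using this
  filter_upwards [key] with x hx
  exact mem_iUnion.1 hx

/-- The upper half of Alexandrov's theorem: a convex function, given through its subgradients
`P x`, has a quadratic upper bound around almost every point. Bounds along the coordinate axes
suffice, since by convexity they propagate to the cross-polytopes spanned by the axes. -/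
lemma ae_exists_le_add_sq {f : E → ℝ} {P : E → E} (hf : Continuous f)
    (hP : ∀ x y, f x + inner ℝ (P x) (y - x) ≤ f y) [Nontrivial E] :
    ∀ᵐ x : E, ∃ C > 0, ∃ δ > 0, ∀ v : E, ‖v‖ ≤ δ →
      f (x + v) ≤ f x + inner ℝ (P x) v + C * ‖v‖ ^ 2 := by
  set N : ℝ := ((Module.finrank ℝ E : ℕ) : ℝ) with hN
  have hNpos : 0 < N := by
    rw [hN]
    exact_mod_cast Module.finrank_pos
  let b := stdOrthonormalBasis ℝ E
  have hall := ae_all_iff.2 fun i => ae_exists_second_difference_le_of_direction hf hP (b i)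
  filter_upwards [hall] with x hx
  choose k hk using hx
  obtain ⟨M, hM⟩ := (Set.finite_range k).bddAbove
  have hM : ∀ i, k i ≤ M := fun i => hM (mem_range_self i)
  have haxis : ∀ i (u : ℝ), |u| ≤ 1 / (M + 1) →
      f (x + u • b i) ≤ f x + u * inner ℝ (P x) (b i) + M * u ^ 2 := by
    intro i u hu
    have hMi : (k i : ℝ) ≤ M := by exact_mod_cast hM i
    have h1 := hk i u (hu.trans (by gcongr))
    have h2 := hP x (x - u • b i)
    rw [sub_sub_cancel_left, inner_neg_right, real_inner_smul_right] at h2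
    have h3 := mul_le_mul_of_nonneg_right hMi (sq_nonneg u)
    linarith
  refine ⟨N * M + 1, by positivity, 1 / (N * (M + 1)), by positivity, fun v hv => ?_⟩
  -- `x + v` is the barycentre of the points `z i` on the coordinate axes through `x`.
  set z : Fin (Module.finrank ℝ E) → E := fun i => x + (N * inner ℝ (b i) v) • b i
  have hz : ∀ i, f (z i) ≤ f x + N * (inner ℝ (b i) v * inner ℝ (P x) (b i))
      + M * N ^ 2 * inner ℝ (b i) v ^ 2 := by
    intro i
    have hle : |inner ℝ (b i) v| ≤ ‖v‖ := by
      have := abs_real_inner_le_norm (b i) v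
      rwa [b.norm_eq_one, one_mul] at this
    have := haxis i (N * inner ℝ (b i) v) (by
      rw [abs_mul, abs_of_pos hNpos]
      calc N * |inner ℝ (b i) v| ≤ N * (1 / (N * (M + 1))) := by gcongr; exact hle.trans hv
        _ = 1 / (M + 1) := by field_simp)
    calc _ ≤ _ := this
      _ = _ := by ring
  have hsum : ∑ i, (z i - (x + v)) = 0 := by
    have : ∑ i, inner ℝ (b i) v • b i = v := b.sum_repr' v
    simp only [z, add_sub_add_left_eq_sub, Finset.sum_sub_distrib, mul_smul, ← Finset.smul_sum,
      this, Finset.sum_const, Finset.card_univ, Fintype.card_fin]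
    rw [← Nat.cast_smul_eq_nsmul ℝ, ← hN, sub_self]
  have hlow : N * f (x + v) ≤ ∑ i, f (z i) := by
    have : ∑ i, (f (x + v) + inner ℝ (P (x + v)) (z i - (x + v))) ≤ ∑ i, f (z i) :=
      Finset.sum_le_sum fun i _ => hP _ _
    rw [Finset.sum_add_distrib, ← inner_sum, hsum, inner_zero_right, add_zero] at this
    simpa using this
  have hup : ∑ i, f (z i) ≤ N * (f x + inner ℝ (P x) v + M * N * ‖v‖ ^ 2) := by
    refine (Finset.sum_le_sum fun i _ => hz i).trans (le_of_eq ?_)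
    have e1 : ∑ i, inner ℝ (b i) v * inner ℝ (P x) (b i) = inner ℝ (P x) v := by
      rw [← b.sum_inner_mul_inner]
      exact Finset.sum_congr rfl fun i _ => mul_comm _ _
    have e2 : ∑ i, inner ℝ (b i) v ^ 2 = ‖v‖ ^ 2 := b.sum_sq_inner_right v
    simp only [Finset.sum_add_distrib, ← Finset.mul_sum, e1, e2, Finset.sum_const,
      Finset.card_univ, Fintype.card_fin, nsmul_eq_mul]
    ring
  have := le_of_mul_le_mul_left (hlow.trans hup) hNpos
  nlinarith [sq_nonneg ‖v‖]

end

/-! ### Contact of a bounded set with its supporting hyperplanes -/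

section

variable {E : Type*} [NormedAddCommGroup E] [InnerProductSpace ℝ E]

/-- In direction `ξ` the set `D` lies in a paraboloid whose apex is a point `p` of `closure D`:
the cap cut off by a hyperplane orthogonal to `ξ` at height `ε` below `p` has diameter `O(√ε)`. -/
def HasParabolicSupport (D : Set E) (ξ : E) : Prop :=
  ∃ p ∈ closure D, ∃ K > 0, ∀ x ∈ D, ‖x - p‖ ^ 2 ≤ K * inner ℝ ξ (p - x)

lemma HasParabolicSupport.smul {D : Set E} {ξ : E} (h : HasParabolicSupport D ξ) {s : ℝ}
    (hs : 0 < s) : HasParabolicSupport D (s • ξ) := by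
  obtain ⟨p, hp, K, hK, hD⟩ := h
  refine ⟨p, hp, K / s, by positivity, fun x hx => (hD x hx).trans (le_of_eq ?_)⟩
  rw [real_inner_smul_left]
  field_simp

variable [FiniteDimensional ℝ E] [MeasurableSpace E] [BorelSpace E]

/-- The quadratic upper bound for the support function `ξ ↦ ⟪ξ, P ξ⟫` at `ξ`, where `P ξ` is
a point of `closure D` farthest in direction `ξ`, is dual to a paraboloid containing `D`. -/
lemma ae_hasParabolicSupport [Nontrivial E] {D : Set E} (hne : D.Nonempty)
    (hb : Bornology.IsBounded D) : ∀ᵐ ξ : E, HasParabolicSupport D ξ := by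
  have hc : IsCompact (closure D) := hb.isCompact_closure
  have hmax : ∀ ξ : E, ∃ p ∈ closure D, ∀ x ∈ closure D, inner ℝ ξ x ≤ inner ℝ ξ p := fun ξ =>
    hc.exists_isMaxOn hne.closure (f := fun x => inner ℝ ξ x) (by fun_prop)
  choose P hPmem hPmax using hmax
  set h : E → ℝ := fun ξ => inner ℝ ξ (P ξ) with hh
  have hsub : ∀ x y, h x + inner ℝ (P x) (y - x) ≤ h y := by
    intro x y
    have := hPmax y (P x) (hPmem x)
    rw [inner_sub_right, real_inner_comm y, real_inner_comm x]
    simp only [hh]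
    linarith
  obtain ⟨R, hRpos, hR⟩ := hb.closure.exists_pos_norm_le
  have hcont : Continuous h := by
    refine (LipschitzWith.of_le_add_mul ⟨R, hRpos.le⟩ fun x y => ?_).continuous
    have h1 := hsub x y
    have h2 : |inner ℝ (P x) (y - x)| ≤ R * dist x y := by
      rw [dist_comm, dist_eq_norm]
      exact (abs_real_inner_le_norm _ _).trans
        (mul_le_mul_of_nonneg_right (hR _ (hPmem x)) (norm_nonneg _))
    change h x ≤ h y + R * dist x y
    linarith [(abs_le.1 h2).1]
  filter_upwards [ae_exists_le_add_sq hcont hsub] with ξ ⟨C, hC, δ, hδ, hξ⟩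
  -- The test vector `c • (x - P ξ)` is short enough for the local bound to apply,
  -- and `C * c ≤ 1 / 2`.
  set c := min (δ / (2 * R)) (1 / (2 * C)) with hcdef
  have hcpos : 0 < c := by positivity
  refine ⟨P ξ, hPmem ξ, 2 / c, by positivity, fun x hx => ?_⟩
  have hxc := subset_closure hx
  have hnorm : ‖x - P ξ‖ ≤ 2 * R := by
    have := norm_sub_le x (P ξ)
    linarith [hR x hxc, hR _ (hPmem ξ)]
  have hsmall : ‖c • (x - P ξ)‖ ≤ δ := by
    rw [norm_smul, Real.norm_of_nonneg hcpos.le]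
    calc c * ‖x - P ξ‖ ≤ δ / (2 * R) * (2 * R) := by
          gcongr
          exact min_le_left _ _
      _ = δ := by field_simp
  have h1 := hξ _ hsmall
  have h2 := hPmax (ξ + c • (x - P ξ)) x hxc
  have h3 : C * c ≤ 1 / 2 := by
    calc C * c ≤ C * (1 / (2 * C)) := by gcongr; exact min_le_right _ _
      _ = 1 / 2 := by field_simp
  have h4 : h (ξ + c • (x - P ξ)) = inner ℝ (ξ + c • (x - P ξ)) (P (ξ + c • (x - P ξ))) := rfl
  have h5 : h ξ = inner ℝ ξ (P ξ) := rfl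
  rw [norm_smul, Real.norm_of_nonneg hcpos.le, h4, h5, real_inner_smul_right] at h1
  rw [inner_add_left, real_inner_smul_left] at h2
  have h6 : inner ℝ (x - P ξ) x - inner ℝ (P ξ) (x - P ξ) = ‖x - P ξ‖ ^ 2 := by
    rw [real_inner_comm (x - P ξ) (P ξ), ← inner_sub_right, real_inner_self_eq_norm_sq]
  rw [inner_sub_right, div_mul_eq_mul_div, le_div_iff₀ hcpos]
  have h7 : C * (c * ‖x - P ξ‖) ^ 2 ≤ 1 / 2 * (c * ‖x - P ξ‖ ^ 2) := by
    calc C * (c * ‖x - P ξ‖) ^ 2 = (C * c) * (c * ‖x - P ξ‖ ^ 2) := by ring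
      _ ≤ _ := by gcongr
  have h8 : c * inner ℝ (x - P ξ) x - c * inner ℝ (P ξ) (x - P ξ) = c * ‖x - P ξ‖ ^ 2 := by
    rw [← mul_sub, h6]
  linarith

/-- A property that holds at almost every vector and is invariant under positive scaling holds
at almost every unit vector. -/
lemma ae_toSphere_of_ae [Nontrivial E] {p : E → Prop} (hp : ∀ᵐ ξ : E, p ξ)
    (hs : ∀ ξ, ∀ s : ℝ, 0 < s → p ξ → p (s • ξ)) :
    ∀ᵐ ω : Metric.sphere (0 : E) 1 ∂(volume : Measure E).toSphere, p ω := by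
  have hmp := (volume : Measure E).measurePreserving_homeomorphUnitSphereProd
  set B : Set (Metric.sphere (0 : E) 1) := {ω | ¬ p ω} with hB
  have h0 : ((volume : Measure E).comap ((↑) : ({0}ᶜ : Set E) → E))
      (homeomorphUnitSphereProd E ⁻¹' (B ×ˢ univ)) = 0 := by
    rw [(MeasurableEmbedding.subtype_coe (measurableSet_singleton _).compl).comap_apply]
    refine measure_mono_null ?_ (ae_iff.1 hp)
    rintro _ ⟨x, hx, rfl⟩ hpx
    have hx0 : (x : E) ≠ 0 := x.2
    refine hx.1 ?_
    rw [homeomorphUnitSphereProd_apply_fst_coe]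
    exact hs _ _ (inv_pos.2 (norm_pos_iff.2 hx0)) hpx
  rw [hmp.measure_preimage_emb (homeomorphUnitSphereProd E).measurableEmbedding,
    Measure.prod_prod, mul_eq_zero] at h0
  rcases h0 with h0 | h0
  · exact h0
  · exfalso
    have h1 : Measure.volumeIoiPow (Module.finrank ℝ E - 1) (Iio ⟨1, mem_Ioi.2 one_pos⟩) = 0 :=
      measure_mono_null (subset_univ _) h0
    rw [Measure.volumeIoiPow_apply_Iio] at h1
    simp only [one_pow, ENNReal.ofReal_eq_zero] at h1
    have : (0 : ℝ) < 1 / ((Module.finrank ℝ E - 1 : ℕ) + 1) := by positivity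
    linarith

lemma ae_toSphere_hasParabolicSupport [Nontrivial E] {D : Set E} (hne : D.Nonempty)
    (hb : Bornology.IsBounded D) :
    ∀ᵐ ω : Metric.sphere (0 : E) 1 ∂(volume : Measure E).toSphere,
      HasParabolicSupport D (ω : E) ∧ HasParabolicSupport D (-(ω : E)) := by
  have h := ae_hasParabolicSupport hne hb
  have hneg := (Measure.measurePreserving_neg (volume : Measure E)).quasiMeasurePreserving.ae h
  refine ae_toSphere_of_ae (p := fun ξ => HasParabolicSupport D ξ ∧ HasParabolicSupport D (-ξ))
    (h.and hneg) fun ξ s hs ⟨h1, h2⟩ => ⟨h1.smul hs, ?_⟩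
  rw [← smul_neg]
  exact h2.smul hs

end

/-! ### Volumes of sections -/

section

variable {E : Type*} [NormedAddCommGroup E] [InnerProductSpace ℝ E] [FiniteDimensional ℝ E]
  [MeasurableSpace E] [BorelSpace E]

/-- Fubini's theorem for the slices orthogonal to a unit vector. -/
lemma volume_eq_lintegral_sections {ω : E} (hω : ‖ω‖ = 1) {S : Set E} (hS : MeasurableSet S) :
    volume S = ∫⁻ t : ℝ, μHE[Module.finrank ℝ E - 1] (S ∩ {x | inner ℝ ω x = t}) := by
  have hω0 : ω ≠ 0 := by
    rintro rfl
    simp at hω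
  rw [← InnerProductSpace.euclideanHausdorffMeasure_eq_volume,
    EuclideanGeometry.euclideanHausdorffMeasure_eq_lintegral (0 : E) hω0 hS]
  have : ‖ω‖ₑ = 1 := by rw [← ofReal_norm, hω, ENNReal.ofReal_one]
  rw [this, one_mul]
  congr with t
  congr 2
  ext x
  simp [AffineSubspace.mem_mk', Submodule.mem_orthogonal_singleton_iff_inner_right,
    inner_sub_right, real_inner_smul_right, hω, sub_eq_zero]

lemma map_inner_restrict_volume {ω : E} (hω : ‖ω‖ = 1) {D : Set E} (hD : MeasurableSet D) :
    (volume.restrict D).map (fun x => inner ℝ ω x) =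
      volume.withDensity fun t => μHE[Module.finrank ℝ E - 1] (D ∩ {x | inner ℝ ω x = t}) := by
  ext S hS
  have hm : Measurable fun x : E => (inner ℝ ω x : ℝ) := by fun_prop
  rw [Measure.map_apply hm hS, Measure.restrict_apply (hm hS), withDensity_apply _ hS,
    volume_eq_lintegral_sections hω ((hm hS).inter hD), ← lintegral_indicator hS]
  congr with t
  by_cases ht : t ∈ S
  · rw [indicator_of_mem ht]
    congr 1
    ext x
    simp only [mem_inter_iff, mem_preimage, mem_ofPred_eq]
    constructor
    · tauto
    · rintro ⟨h1, rfl⟩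
      tauto
  · rw [indicator_of_notMem ht]
    convert measure_empty (μ := μHE[Module.finrank ℝ E - 1])
    ext x
    simp only [mem_inter_iff, mem_preimage, mem_ofPred_eq, mem_empty_iff_false, iff_false]
    rintro ⟨⟨h1, -⟩, rfl⟩
    exact ht h1

/-- The volume of a section, computed in the linear hyperplane `ωᗮ`. -/
lemma section_volume_eq {ω : E} (hω : ‖ω‖ = 1) (S : Set E) (t : ℝ) :
    μHE[Module.finrank ℝ E - 1] (S ∩ {x | inner ℝ ω x = t}) =
      volume {y : (ℝ ∙ ω)ᗮ | t • ω + (y : E) ∈ S} := by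
  have hω0 : ω ≠ 0 := by
    rintro rfl
    simp at hω
  have hiso : Isometry fun y : (ℝ ∙ ω)ᗮ => t • ω + (y : E) :=
    (isometry_add_left (t • ω)).comp isometry_subtype_coe
  have hrank : Module.finrank ℝ (ℝ ∙ ω)ᗮ = Module.finrank ℝ E - 1 := by
    have := (ℝ ∙ ω).finrank_add_finrank_orthogonal
    rw [finrank_span_singleton hω0] at this
    omega
  rw [← InnerProductSpace.euclideanHausdorffMeasure_eq_volume, hrank,
    ← hiso.euclideanHausdorffMeasure_image]
  congr 1
  ext x
  simp only [mem_inter_iff, mem_ofPred_eq, mem_image]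
  constructor
  · rintro ⟨hx, hxt⟩
    refine ⟨⟨x - t • ω, ?_⟩, ?_, ?_⟩
    · rw [Submodule.mem_orthogonal_singleton_iff_inner_right, inner_sub_right,
        real_inner_smul_right, real_inner_self_eq_norm_sq, hω, hxt]
      ring
    · simpa using hx
    · simp
  · rintro ⟨y, hy, rfl⟩
    refine ⟨hy, ?_⟩
    have := Submodule.mem_orthogonal_singleton_iff_inner_right.1 y.2
    rw [inner_add_right, real_inner_smul_right, real_inner_self_eq_norm_sq, hω, this]
    ring

/-- A section that lies in a ball of radius `ρ` has volume `O(ρ ^ (dim - 1))`. -/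
lemma section_volume_le {ω : E} (hω : ‖ω‖ = 1) {S : Set E} {t ρ : ℝ} (hρ : 0 ≤ ρ) {p : E}
    (hS : ∀ x ∈ S, inner ℝ ω x = t → ‖x - p‖ ≤ ρ) :
    μHE[Module.finrank ℝ E - 1] (S ∩ {x | inner ℝ ω x = t}) ≤
      ENNReal.ofReal ((2 * ρ) ^ (Module.finrank ℝ E - 1)) *
        volume (Metric.closedBall (0 : (ℝ ∙ ω)ᗮ) 1) := by
  have hω0 : ω ≠ 0 := by
    rintro rfl
    simp at hω
  have hrank : Module.finrank ℝ (ℝ ∙ ω)ᗮ = Module.finrank ℝ E - 1 := by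
    have := (ℝ ∙ ω).finrank_add_finrank_orthogonal
    rw [finrank_span_singleton hω0] at this
    omega
  rw [section_volume_eq hω]
  rcases Set.eq_empty_or_nonempty {y : (ℝ ∙ ω)ᗮ | t • ω + (y : E) ∈ S} with he | ⟨y₀, hy₀⟩
  · rw [he, measure_empty]
    exact zero_le
  have hin : ∀ y : (ℝ ∙ ω)ᗮ, inner ℝ ω (t • ω + (y : E)) = t := fun y => by
    have := Submodule.mem_orthogonal_singleton_iff_inner_right.1 y.2
    rw [inner_add_right, real_inner_smul_right, real_inner_self_eq_norm_sq, hω, this]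
    ring
  rw [← hrank, ← Measure.addHaar_closedBall' _ y₀ (by positivity)]
  refine measure_mono fun y hy => ?_
  have h1 := hS _ hy (hin y)
  have h2 := hS _ hy₀ (hin y₀)
  rw [Metric.mem_closedBall, dist_eq_norm, Submodule.coe_norm, Submodule.coe_sub]
  calc ‖(y : E) - y₀‖ = ‖(t • ω + (y : E) - p) - (t • ω + (y₀ : E) - p)‖ := by
        congr 1
        abel
    _ ≤ 2 * ρ := by linarith [norm_sub_le (t • ω + (y : E) - p) (t • ω + (y₀ : E) - p)]

end

/-- The density `(b - t)ᵐ (t - a)ᵐ` on the interval `(a, b)`, extended by zero. -/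
noncomputable def bumpDensity (m : ℕ) (a b : ℝ) : ℝ → ENNReal :=
  (Ioo a b).indicator fun t => ENNReal.ofReal ((b - t) ^ m * (t - a) ^ m)

lemma measurable_bumpDensity (m : ℕ) (a b : ℝ) : Measurable (bumpDensity m a b) :=
  Measurable.indicator (by fun_prop) measurableSet_Ioo

section

variable {E : Type*} [NormedAddCommGroup E] [InnerProductSpace ℝ E] [FiniteDimensional ℝ E]
  [MeasurableSpace E] [BorelSpace E]

/-- The section of the unit ball at height `t ∈ (-1, 1)` is a ball of radius `√(1 - t²)`. -/
lemma section_volume_ball {ω : E} (hω : ‖ω‖ = 1) {m : ℕ} (hm : Module.finrank ℝ E = 2 * m + 1)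
    (t : ℝ) :
    μHE[Module.finrank ℝ E - 1] (Metric.ball 0 1 ∩ {x | inner ℝ ω x = t}) =
      volume (Metric.ball (0 : (ℝ ∙ ω)ᗮ) 1) * bumpDensity m (-1) 1 t := by
  have hω0 : ω ≠ 0 := by
    rintro rfl
    simp at hω
  by_cases ht : t ∈ Ioo (-1 : ℝ) 1
  · have hrank : Module.finrank ℝ (ℝ ∙ ω)ᗮ = 2 * m := by
      have := (ℝ ∙ ω).finrank_add_finrank_orthogonal
      rw [finrank_span_singleton hω0] at this
      omega
    have hpos : 0 < 1 - t ^ 2 := by nlinarith [ht.1, ht.2]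
    have hset : {y : (ℝ ∙ ω)ᗮ | t • ω + (y : E) ∈ Metric.ball (0 : E) 1} =
        Metric.ball 0 (√(1 - t ^ 2)) := by
      ext y
      have h0 := Submodule.mem_orthogonal_singleton_iff_inner_right.1 y.2
      have h1 : ‖t • ω + (y : E)‖ ^ 2 = t ^ 2 + ‖y‖ ^ 2 := by
        rw [norm_add_sq_real, real_inner_smul_left, h0, norm_smul, hω]
        simp
      rw [mem_ofPred_eq, mem_ball_zero_iff, mem_ball_zero_iff, Real.lt_sqrt (norm_nonneg _),
        ← sq_lt_one_iff₀ (norm_nonneg _), h1]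
      constructor <;> intro h <;> linarith
    rw [section_volume_eq hω, hset, Measure.addHaar_ball_of_pos _ _ (Real.sqrt_pos.2 hpos), hrank,
      pow_mul, Real.sq_sqrt hpos.le, bumpDensity, indicator_of_mem ht, ← mul_pow, mul_comm]
    congr 3
    ring
  · rw [bumpDensity, indicator_of_notMem ht, mul_zero]
    convert measure_empty (μ := μHE[Module.finrank ℝ E - 1])
    ext x
    simp only [mem_inter_iff, mem_ball_zero_iff, mem_ofPred_eq, mem_empty_iff_false, iff_false]
    rintro ⟨h1, rfl⟩
    have := abs_real_inner_le_norm ω x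
    rw [hω, one_mul] at this
    exact ht (abs_lt.1 (this.trans_lt h1))

end

/-! ### Polynomial section functions vanishing at both ends -/

/-- A polynomial that is `O(|t - b| ^ k)` as `t → b` is divisible by `(X - b) ^ k`. -/
lemma X_sub_C_pow_dvd_of_eventually_le {p : Polynomial ℝ} {b B : ℝ} {k : ℕ} {l : Filter ℝ}
    [l.NeBot] (hl : l ≤ 𝓝[≠] b) (h : ∀ᶠ t in l, |p.eval t| ≤ B * |t - b| ^ k) :
    (Polynomial.X - Polynomial.C b) ^ k ∣ p := by
  rcases eq_or_ne p 0 with rfl | hp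
  · exact dvd_zero _
  by_contra hcon
  rw [← Polynomial.le_rootMultiplicity_iff hp, not_le] at hcon
  set j := p.rootMultiplicity b with hj
  obtain ⟨q, hq, hndvd⟩ := p.exists_eq_pow_rootMultiplicity_mul_and_not_dvd hp b
  rw [← hj] at hq
  refine hndvd (Polynomial.dvd_iff_isRoot.2 ?_)
  have hev : ∀ᶠ t in l, |q.eval t| ≤ B * |t - b| ^ (k - j) := by
    filter_upwards [h, hl self_mem_nhdsWithin] with t ht htb
    have hpos : 0 < |t - b| ^ j := pow_pos (abs_pos.2 (sub_ne_zero.2 htb)) _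
    have hsplit : |t - b| ^ k = |t - b| ^ j * |t - b| ^ (k - j) := by
      rw [← pow_add, Nat.add_sub_cancel' hcon.le]
    rw [hq, Polynomial.eval_mul, abs_mul, hsplit] at ht
    simp only [Polynomial.eval_pow, Polynomial.eval_sub, Polynomial.eval_X, Polynomial.eval_C,
      abs_pow] at ht
    refine le_of_mul_le_mul_left ?_ hpos
    linarith
  have hl' : l ≤ 𝓝 b := hl.trans nhdsWithin_le_nhds
  have hlim : Tendsto (fun t => |q.eval t|) l (𝓝 |q.eval b|) :=
    (q.continuous.abs.tendsto b).mono_left hl'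
  have hlim0 : Tendsto (fun t : ℝ => B * |t - b| ^ (k - j)) l (𝓝 0) := by
    have : Continuous fun t : ℝ => B * |t - b| ^ (k - j) := by fun_prop
    have h0 : B * |b - b| ^ (k - j) = 0 := by
      rw [sub_self, abs_zero, zero_pow (by omega), mul_zero]
    simpa only [h0] using (this.tendsto b).mono_left hl'
  exact abs_nonpos_iff.1 (le_of_tendsto_of_tendsto hlim hlim0 hev)

lemma exists_eval_eq_of_dvd_of_natDegree_le {p : Polynomial ℝ} {a b : ℝ} {m : ℕ} (hab : a ≠ b)
    (hdeg : p.natDegree ≤ 2 * m) (ha : (Polynomial.X - Polynomial.C a) ^ m ∣ p)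
    (hb : (Polynomial.X - Polynomial.C b) ^ m ∣ p) :
    ∃ A : ℝ, ∀ t, p.eval t = A * ((b - t) ^ m * (t - a) ^ m) := by
  have hcop : IsCoprime ((Polynomial.X - Polynomial.C a) ^ m)
      ((Polynomial.X - Polynomial.C b) ^ m) :=
    (Polynomial.isCoprime_X_sub_C_of_isUnit_sub (sub_ne_zero.2 hab).isUnit).pow
  obtain ⟨q, rfl⟩ := hcop.mul_dvd ha hb
  have hmon : ((Polynomial.X - Polynomial.C a) ^ m * (Polynomial.X - Polynomial.C b) ^ m).Monic :=
    ((Polynomial.monic_X_sub_C a).pow m).mul ((Polynomial.monic_X_sub_C b).pow m)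
  have hq : q.natDegree = 0 := by
    rcases eq_or_ne q 0 with rfl | hq0
    · simp
    rw [hmon.natDegree_mul' hq0, (((Polynomial.monic_X_sub_C a).pow m).natDegree_mul
      ((Polynomial.monic_X_sub_C b).pow m)), Polynomial.natDegree_pow, Polynomial.natDegree_pow,
      Polynomial.natDegree_X_sub_C, Polynomial.natDegree_X_sub_C] at hdeg
    omega
  rw [Polynomial.eq_C_of_natDegree_eq_zero hq]
  refine ⟨(-1) ^ m * q.coeff 0, fun t => ?_⟩
  have : b - t = -1 * (t - b) := by ring
  rw [this, mul_pow]
  simp only [Polynomial.eval_mul, Polynomial.eval_pow, Polynomial.eval_sub, Polynomial.eval_X,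
    Polynomial.eval_C]
  have h1 : ((-1 : ℝ) ^ m) * (-1) ^ m = 1 := by rw [← mul_pow]; simp
  linear_combination (-(t - a) ^ m * (t - b) ^ m * q.coeff 0) * h1

section

variable {E : Type*} [NormedAddCommGroup E] [InnerProductSpace ℝ E]

/-- The heights of the hyperplanes orthogonal to `ω` that meet a connected open set `D` form the
open interval between the heights of two extreme points of `closure D`. -/
lemma image_inner_eq_Ioo {ω : E} (hω : ‖ω‖ = 1) {D : Set E} (hDo : IsOpen D)
    (hDc : IsPreconnected D) {p q : E} (hp : p ∈ closure D) (hq : q ∈ closure D)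
    (hpmax : ∀ x ∈ D, inner ℝ ω x ≤ inner ℝ ω p) (hqmin : ∀ x ∈ D, inner ℝ ω q ≤ inner ℝ ω x) :
    (fun x => inner ℝ ω x) '' D = Ioo (inner ℝ ω q) (inner ℝ ω p : ℝ) := by
  have hcont : Continuous fun x : E => (inner ℝ ω x : ℝ) := by fun_prop
  have hself : inner ℝ ω ω = 1 := by rw [real_inner_self_eq_norm_sq, hω, one_pow]
  have hshift : ∀ x ∈ D, ∃ ε : ℝ, 0 < ε ∧ x + ε • ω ∈ D ∧ x - ε • ω ∈ D := by
    intro x hx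
    obtain ⟨r, hr, hball⟩ := Metric.isOpen_iff.1 hDo x hx
    refine ⟨r / 2, by positivity, hball ?_, hball ?_⟩ <;>
      simp [dist_eq_norm, norm_smul, hω, abs_of_pos hr, hr]
  apply Subset.antisymm
  · rintro _ ⟨x, hx, rfl⟩
    obtain ⟨ε, hε, h1, h2⟩ := hshift x hx
    have h3 := hpmax _ h1
    have h4 := hqmin _ h2
    rw [inner_add_right, real_inner_smul_right, hself] at h3
    rw [inner_sub_right, real_inner_smul_right, hself] at h4
    constructor <;> simp only <;> linarith
  · intro t ht
    have hup : ∃ x ∈ D, t < inner ℝ ω x := by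
      obtain ⟨x, hx, hxD⟩ := mem_closure_iff.1 hp _ (isOpen_Ioi.preimage hcont) ht.2
      exact ⟨x, hxD, hx⟩
    have hlow : ∃ x ∈ D, inner ℝ ω x < t := by
      obtain ⟨x, hx, hxD⟩ := mem_closure_iff.1 hq _ (isOpen_Iio.preimage hcont) ht.1
      exact ⟨x, hxD, hx⟩
    obtain ⟨x, hx, hxt⟩ := hup
    obtain ⟨y, hy, hyt⟩ := hlow
    exact (hDc.image _ hcont.continuousOn).ordConnected.out (mem_image_of_mem _ hy)
      (mem_image_of_mem _ hx) ⟨hyt.le, hxt.le⟩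

variable [FiniteDimensional ℝ E] [MeasurableSpace E] [BorelSpace E]

/-- Contact with a paraboloid makes the sections shrink like `(b - t) ^ m` near the top. -/
lemma exists_section_volume_le {ω : E} (hω : ‖ω‖ = 1) {m : ℕ}
    (hm : Module.finrank ℝ E = 2 * m + 1) {D : Set E} {p : E} {K : ℝ} (hK : 0 < K)
    (hD : ∀ x ∈ D, ‖x - p‖ ^ 2 ≤ K * inner ℝ ω (p - x)) :
    ∃ B : ℝ, ∀ t ≤ inner ℝ ω p,
      (μHE[Module.finrank ℝ E - 1] (D ∩ {x | inner ℝ ω x = t})) ≠ ⊤ ∧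
      (μHE[Module.finrank ℝ E - 1] (D ∩ {x | inner ℝ ω x = t})).toReal ≤
        B * |t - inner ℝ ω p| ^ m := by
  refine ⟨(4 * K) ^ m * (volume (Metric.closedBall (0 : (ℝ ∙ ω)ᗮ) 1)).toReal, fun t ht => ?_⟩
  have hfin : volume (Metric.closedBall (0 : (ℝ ∙ ω)ᗮ) 1) ≠ ⊤ := measure_closedBall_lt_top.ne
  have hnn : 0 ≤ K * (inner ℝ ω p - t) := mul_nonneg hK.le (sub_nonneg.2 ht)
  have hle := section_volume_le hω (Real.sqrt_nonneg (K * (inner ℝ ω p - t))) (S := D) (t := t)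
    (p := p) fun x hx hxt => by
      apply Real.le_sqrt_of_sq_le
      have := hD x hx
      rwa [inner_sub_right, hxt] at this
  have hpow : (2 * √(K * (inner ℝ ω p - t))) ^ (Module.finrank ℝ E - 1) =
      (4 * K) ^ m * |t - inner ℝ ω p| ^ m := by
    rw [hm, Nat.add_sub_cancel, pow_mul, mul_pow, Real.sq_sqrt hnn, ← mul_pow, abs_sub_comm,
      abs_of_nonneg (sub_nonneg.2 ht)]
    ring
  refine ⟨ne_top_of_le_ne_top (ENNReal.mul_ne_top ENNReal.ofReal_ne_top hfin) hle, ?_⟩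
  refine (ENNReal.toReal_mono (ENNReal.mul_ne_top ENNReal.ofReal_ne_top hfin) hle).trans
    (le_of_eq ?_)
  rw [ENNReal.toReal_mul, ENNReal.toReal_ofReal (by positivity), hpow]
  ring

/-- If the section function of `D` in direction `ω` is a polynomial of degree at most `2 m` and
`D` has paraboloidal contact at both ends, then the polynomial has a zero of order `m` at each end,
so it is a multiple of `(b - t)ᵐ (t - a)ᵐ`. -/
lemma exists_section_volume_eq_bumpDensity {ω : E} (hω : ‖ω‖ = 1) {m : ℕ}
    (hm : Module.finrank ℝ E = 2 * m + 1) {D : Set E} (hDo : IsOpen D) (hDc : IsConnected D)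
    (hsup : HasParabolicSupport D ω) (hsup' : HasParabolicSupport D (-ω)) {P : Polynomial ℝ}
    (hdeg : P.natDegree ≤ 2 * m) (hP : ∀ t : ℝ, (D ∩ {x | inner ℝ ω x = t}).Nonempty →
      (μHE[Module.finrank ℝ E - 1] (D ∩ {x | inner ℝ ω x = t})).toReal = P.eval t) :
    ∃ a b A : ℝ, a < b ∧ ∀ t, μHE[Module.finrank ℝ E - 1] (D ∩ {x | inner ℝ ω x = t}) =
      ENNReal.ofReal A * bumpDensity m a b t := by
  obtain ⟨p, hp, K, hK, hDp⟩ := hsup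
  obtain ⟨q, hq, L, hL, hDq⟩ := hsup'
  have hpmax : ∀ x ∈ D, inner ℝ ω x ≤ inner ℝ ω p := fun x hx => by
    have := nonneg_of_mul_nonneg_right ((sq_nonneg _).trans (hDp x hx)) hK
    rwa [inner_sub_right, sub_nonneg] at this
  have hqmin : ∀ x ∈ D, inner ℝ ω q ≤ inner ℝ ω x := fun x hx => by
    have := nonneg_of_mul_nonneg_right ((sq_nonneg _).trans (hDq x hx)) hL
    rw [inner_sub_right, inner_neg_left, inner_neg_left] at this
    linarith
  have himg := image_inner_eq_Ioo hω hDo hDc.isPreconnected hp hq hpmax hqmin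
  set b : ℝ := inner ℝ ω p with hb
  set a : ℝ := inner ℝ ω q with ha
  have hab : a < b := by
    have := hDc.nonempty.image fun x => (inner ℝ ω x : ℝ)
    rw [himg] at this
    exact nonempty_Ioo.1 this
  have hne : ∀ t ∈ Ioo a b, (D ∩ {x | inner ℝ ω x = t}).Nonempty := fun t ht => by
    rw [← himg] at ht
    obtain ⟨x, hx, hxt⟩ := ht
    exact ⟨x, hx, hxt⟩
  obtain ⟨B₁, hB₁⟩ := exists_section_volume_le hω hm hK hDp
  obtain ⟨B₂, hB₂⟩ := exists_section_volume_le (ω := -ω) (by rwa [norm_neg]) hm hL hDq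
  have hflip : ∀ t : ℝ, {x : E | inner ℝ (-ω) x = -t} = {x | inner ℝ ω x = t} := fun t => by
    ext x
    simp
  have hdb : (Polynomial.X - Polynomial.C b) ^ m ∣ P := by
    refine X_sub_C_pow_dvd_of_eventually_le (l := 𝓝[<] b) (B := B₁)
      (nhdsWithin_mono _ fun t ht => ne_of_lt ht) ?_
    filter_upwards [Ioo_mem_nhdsLT hab] with t ht
    rw [← hP t (hne t ht), abs_of_nonneg ENNReal.toReal_nonneg]
    exact (hB₁ t ht.2.le).2
  have hda : (Polynomial.X - Polynomial.C a) ^ m ∣ P := by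
    refine X_sub_C_pow_dvd_of_eventually_le (l := 𝓝[>] a) (B := B₂)
      (nhdsWithin_mono _ fun t ht => ne_of_gt ht) ?_
    filter_upwards [Ioo_mem_nhdsGT hab] with t ht
    rw [← hP t (hne t ht), abs_of_nonneg ENNReal.toReal_nonneg]
    have := (hB₂ (-t) (by rw [inner_neg_left]; exact neg_le_neg ht.1.le)).2
    rw [hflip, inner_neg_left, neg_sub_neg, abs_sub_comm] at this
    exact this
  obtain ⟨A, hA⟩ := exists_eval_eq_of_dvd_of_natDegree_le hab.ne hdeg hda hdb
  refine ⟨a, b, A, hab, fun t => ?_⟩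
  by_cases ht : t ∈ Ioo a b
  · rw [bumpDensity, indicator_of_mem ht, ← ENNReal.ofReal_mul'
      (mul_nonneg (pow_nonneg (sub_nonneg.2 ht.2.le) _) (pow_nonneg (sub_nonneg.2 ht.1.le) _)),
      ← hA, ← hP t (hne t ht), ENNReal.ofReal_toReal (hB₁ t ht.2.le).1]
  · rw [bumpDensity, indicator_of_notMem ht, mul_zero]
    convert measure_empty (μ := μHE[Module.finrank ℝ E - 1])
    ext x
    simp only [mem_inter_iff, mem_ofPred_eq, mem_empty_iff_false, iff_false]
    rintro ⟨hx, rfl⟩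
    exact ht (himg ▸ mem_image_of_mem _ hx)

end

/-! ### One-dimensional marginals of uniform measures -/

/-- The probability measure on `ℝ` with density proportional to `(1 - t²)ᵐ` on `(-1, 1)`. -/
noncomputable def bumpMeasure (m : ℕ) : Measure ℝ :=
  (volume.withDensity (bumpDensity m (-1) 1) univ)⁻¹ • volume.withDensity (bumpDensity m (-1) 1)

lemma withDensity_bumpDensity_affine (m : ℕ) (c : ℝ) {r : ℝ} (hr : 0 < r) :
    volume.withDensity (bumpDensity m (c - r) (c + r)) =
      ENNReal.ofReal (r ^ (2 * m + 1)) •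
        (volume.withDensity (bumpDensity m (-1) 1)).map (fun s => c + r * s) := by
  ext S hS
  have hmeas : Measurable fun s : ℝ => c + r * s := by fun_prop
  have hinj : Function.Injective fun s : ℝ => c + r * s := fun x y h => by
    simpa [hr.ne'] using h
  have hsurj : Function.Surjective fun s : ℝ => c + r * s := fun y =>
    ⟨(y - c) / r, by simp only; field_simp; ring⟩
  rw [Measure.smul_apply, Measure.map_apply hmeas hS, withDensity_apply _ hS,
    withDensity_apply _ (hmeas hS), smul_eq_mul]
  have hcv := lintegral_image_eq_lintegral_abs_deriv_mul (hmeas hS)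
    (f := fun s : ℝ => c + r * s) (f' := fun _ => r)
    (fun x _ => by simpa using (((hasDerivAt_id x).const_mul r).const_add c).hasDerivWithinAt)
    hinj.injOn (bumpDensity m (c - r) (c + r))
  rw [image_preimage_eq _ hsurj] at hcv
  rw [hcv, ← lintegral_const_mul _ (measurable_bumpDensity _ _ _)]
  refine lintegral_congr fun s => ?_
  by_cases hs : s ∈ Ioo (-1 : ℝ) 1
  · have hs' : c + r * s ∈ Ioo (c - r) (c + r) := by
      constructor <;> nlinarith [hs.1, hs.2]
    rw [bumpDensity, bumpDensity, indicator_of_mem hs, indicator_of_mem hs', abs_of_pos hr,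
      ← ENNReal.ofReal_mul hr.le, ← ENNReal.ofReal_mul (by positivity)]
    congr 1
    have e1 : c + r - (c + r * s) = r * (1 - s) := by ring
    have e2 : c + r * s - (c - r) = r * (s - -1) := by ring
    rw [e1, e2, mul_pow, mul_pow]
    ring
  · have hs' : c + r * s ∉ Ioo (c - r) (c + r) := fun h => hs
      ⟨by nlinarith [h.1], by nlinarith [h.2]⟩
    rw [bumpDensity, bumpDensity, indicator_of_notMem hs, indicator_of_notMem hs', mul_zero,
      mul_zero]

/-- A probability measure with density proportional to `(b - t)ᵐ (t - a)ᵐ` on `(a, b)` is an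
affine image of `bumpMeasure m`; the normalisation fixes the factor of proportionality. -/
lemma eq_map_bumpMeasure_of_isProbabilityMeasure {m : ℕ} {a b : ℝ} (hab : a < b) {K : ENNReal}
    {μ : Measure ℝ} [IsProbabilityMeasure μ] (hμ : μ = K • volume.withDensity (bumpDensity m a b)) :
    μ = (bumpMeasure m).map fun s => (a + b) / 2 + (b - a) / 2 * s := by
  have hr : 0 < (b - a) / 2 := by linarith
  have h := withDensity_bumpDensity_affine m ((a + b) / 2) hr
  have ha : (a + b) / 2 - (b - a) / 2 = a := by ring
  have hb : (a + b) / 2 + (b - a) / 2 = b := by ring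
  rw [ha, hb] at h
  rw [h, smul_smul] at hμ
  have huniv : μ univ = 1 := measure_univ
  rw [hμ, Measure.smul_apply, Measure.map_apply (by fun_prop) MeasurableSet.univ, preimage_univ,
    smul_eq_mul] at huniv
  rw [hμ, bumpMeasure, Measure.map_smul, ← ENNReal.eq_inv_of_mul_eq_one_left huniv]

section

variable {E : Type*} [NormedAddCommGroup E] [InnerProductSpace ℝ E] [FiniteDimensional ℝ E]
  [MeasurableSpace E] [BorelSpace E]

lemma isProbabilityMeasure_cond_volume {D : Set E} (hDo : IsOpen D) (hne : D.Nonempty)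
    (hb : Bornology.IsBounded D) :
    IsProbabilityMeasure (ProbabilityTheory.cond (volume : Measure E) D) :=
  ProbabilityTheory.cond_isProbabilityMeasure_of_finite (hDo.measure_pos _ hne).ne'
    hb.measure_lt_top.ne

/-- If the sections of `D` orthogonal to `ω` have volumes proportional to `(b - t)ᵐ (t - a)ᵐ`,
then the marginal in direction `ω` of the uniform distribution on `D` is an affine image of
`bumpMeasure m`. -/
lemma map_inner_cond_eq_map_bumpMeasure {ω : E} (hω : ‖ω‖ = 1) {m : ℕ} {D : Set E}
    (hDo : IsOpen D) (hne : D.Nonempty) (hbd : Bornology.IsBounded D) {a b : ℝ} (hab : a < b)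
    {A : ENNReal} (hA : ∀ t, μHE[Module.finrank ℝ E - 1] (D ∩ {x | inner ℝ ω x = t}) =
      A * bumpDensity m a b t) :
    (ProbabilityTheory.cond (volume : Measure E) D).map (fun x => inner ℝ ω x) =
      (bumpMeasure m).map fun s => (a + b) / 2 + (b - a) / 2 * s := by
  have := isProbabilityMeasure_cond_volume hDo hne hbd
  have hm : Measurable fun x : E => (inner ℝ ω x : ℝ) := by fun_prop
  have := Measure.isProbabilityMeasure_map
    (μ := ProbabilityTheory.cond (volume : Measure E) D) hm.aemeasurable
  refine eq_map_bumpMeasure_of_isProbabilityMeasure hab (K := (volume D)⁻¹ * A) ?_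
  have hfun : (fun t => μHE[Module.finrank ℝ E - 1] (D ∩ {x | inner ℝ ω x = t})) =
      A • bumpDensity m a b := funext hA
  rw [ProbabilityTheory.cond, Measure.map_smul, map_inner_restrict_volume hω hDo.measurableSet,
    hfun, withDensity_smul _ (measurable_bumpDensity _ _ _), smul_smul]

lemma map_inner_cond_ball {ω : E} (hω : ‖ω‖ = 1) {m : ℕ}
    (hm : Module.finrank ℝ E = 2 * m + 1) :
    (ProbabilityTheory.cond (volume : Measure E) (Metric.ball 0 1)).map (fun x => inner ℝ ω x) =
      bumpMeasure m := by
  rw [map_inner_cond_eq_map_bumpMeasure hω Metric.isOpen_ball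
    (Metric.nonempty_ball.2 one_pos) Metric.isBounded_ball (by norm_num)
    (section_volume_ball hω hm)]
  norm_num

lemma memLp_id_cond_volume {D : Set E} (hDo : IsOpen D) (hne : D.Nonempty)
    (hbd : Bornology.IsBounded D) :
    MemLp id 2 (ProbabilityTheory.cond (volume : Measure E) D) := by
  have := isProbabilityMeasure_cond_volume hDo hne hbd
  obtain ⟨R, hR⟩ := hbd.exists_norm_le
  refine MemLp.of_bound aestronglyMeasurable_id R ?_
  filter_upwards [ProbabilityTheory.ae_cond_mem hDo.measurableSet] with x hx
  exact hR x hx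

/-- The uniform distribution on a bounded open set has positive variance in every direction. -/
lemma variance_inner_cond_pos {ω : E} (hω : ω ≠ 0) {D : Set E}
    (hDo : IsOpen D) (hne : D.Nonempty) (hbd : Bornology.IsBounded D) :
    0 < ProbabilityTheory.variance (fun x => inner ℝ ω x)
      (ProbabilityTheory.cond (volume : Measure E) D) := by
  have := isProbabilityMeasure_cond_volume hDo hne hbd
  have hD0 : volume D ≠ 0 := (hDo.measure_pos _ hne).ne'
  refine lt_of_le_of_ne (ProbabilityTheory.variance_nonneg _ _) fun h0 => ?_
  have hL : MemLp (fun x => (inner ℝ ω x : ℝ)) 2 (ProbabilityTheory.cond (volume : Measure E) D) :=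
    (memLp_id_cond_volume hDo hne hbd).const_inner ω
  have hae := ProbabilityTheory.ae_eq_integral_of_variance_eq_zero hL h0.symm
  set c := ∫ x, (inner ℝ ω x : ℝ) ∂(ProbabilityTheory.cond (volume : Measure E) D)
  have h1 : ∀ᵐ x ∂volume.restrict D, inner ℝ ω x = c := by
    change ∀ᵐ x ∂_, inner ℝ ω x = c at hae
    rw [ae_iff] at hae ⊢
    rw [ProbabilityTheory.cond, Measure.smul_apply, smul_eq_mul, mul_eq_zero] at hae
    exact hae.resolve_left (ENNReal.inv_ne_zero.2 hbd.measure_lt_top.ne)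
  rw [ae_restrict_iff' hDo.measurableSet] at h1
  -- `D` is almost contained in a hyperplane, which is a null set.
  have h2 : volume {x : E | inner ℝ ω x = c} = 0 := by
    have hs : {x : E | inner ℝ ω x = c} =
        ((AffineSubspace.mk' ((c / ‖ω‖ ^ 2) • ω) (ℝ ∙ ω)ᗮ : AffineSubspace ℝ E) : Set E) := by
      have hn : ‖ω‖ ≠ 0 := norm_ne_zero_iff.2 hω
      ext x
      simp [AffineSubspace.mem_mk', Submodule.mem_orthogonal_singleton_iff_inner_right,
        inner_sub_right, real_inner_smul_right, sub_eq_zero, hn]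
    rw [hs]
    refine Measure.addHaar_affineSubspace _ _ fun htop => ?_
    have := congrArg AffineSubspace.direction htop
    rw [AffineSubspace.direction_mk', AffineSubspace.direction_top,
      Submodule.orthogonal_eq_top_iff, Submodule.span_singleton_eq_bot] at this
    exact hω this
  refine hD0 (measure_mono_null (t := {x | ¬ (x ∈ D → inner ℝ ω x = c)} ∪ {x | inner ℝ ω x = c})
    (fun x hx => ?_) (measure_union_null (ae_iff.1 h1) h2))
  by_cases hxc : inner ℝ ω x = c
  · exact Or.inr hxc
  · exact Or.inl fun h => hxc (h hx)

end

/-! ### Measures whose marginals are affine images of one law -/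

section

open ProbabilityTheory

variable {E : Type*} [NormedAddCommGroup E] [InnerProductSpace ℝ E]

/-- The linear map that is diagonal in the orthonormal basis `b` with entries `a`. -/
noncomputable def diagonalMap {n : ℕ} (b : OrthonormalBasis (Fin n) ℝ E) (a : Fin n → ℝ)
    (x : E) : E :=
  ∑ j, (a j * inner ℝ (b j) x) • b j

lemma continuous_diagonalMap {n : ℕ} (b : OrthonormalBasis (Fin n) ℝ E) (a : Fin n → ℝ) :
    Continuous (diagonalMap b a) := by
  unfold diagonalMap
  fun_prop

lemma inner_diagonalMap {n : ℕ} (b : OrthonormalBasis (Fin n) ℝ E) (a : Fin n → ℝ) (x : E)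
    (i : Fin n) : inner ℝ (b i) (diagonalMap b a x) = a i * inner ℝ (b i) x := by
  classical
  simp [diagonalMap, inner_sum, real_inner_smul_right, b.inner_eq_ite]

lemma inner_diagonalMap_left {n : ℕ} (b : OrthonormalBasis (Fin n) ℝ E) (a : Fin n → ℝ)
    (x y : E) : inner ℝ (diagonalMap b a x) y = inner ℝ x (diagonalMap b a y) := by
  rw [← b.sum_inner_mul_inner, ← b.sum_inner_mul_inner x]
  refine Finset.sum_congr rfl fun i _ => ?_
  rw [real_inner_comm, inner_diagonalMap, inner_diagonalMap, real_inner_comm x]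
  ring

lemma norm_diagonalMap_sq {n : ℕ} (b : OrthonormalBasis (Fin n) ℝ E) (a : Fin n → ℝ) (x : E) :
    ‖diagonalMap b a x‖ ^ 2 = ∑ j, a j ^ 2 * inner ℝ (b j) x ^ 2 := by
  rw [← b.sum_sq_inner_right]
  refine Finset.sum_congr rfl fun i _ => ?_
  rw [inner_diagonalMap, mul_pow]

variable [FiniteDimensional ℝ E] [MeasurableSpace E] [BorelSpace E]

lemma charFun_smul_eq_charFun_map_inner (ν : Measure E) (ω : E) (s : ℝ) :
    charFun ν (s • ω) = charFun (ν.map fun x => inner ℝ ω x) s := by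
  rw [charFun_apply, charFun_apply, integral_map (by fun_prop) (by fun_prop)]
  refine integral_congr_ae (ae_of_all _ fun x => ?_)
  simp only [real_inner_smul_right, RCLike.inner_apply, conj_trivial, real_inner_comm]

lemma charFun_map_add_diagonalMap {n : ℕ} (ν : Measure E) (b : OrthonormalBasis (Fin n) ℝ E)
    (a : Fin n → ℝ) (g ξ : E) :
    charFun (ν.map fun x => g + diagonalMap b a x) ξ =
      charFun ν (diagonalMap b a ξ) * Complex.exp (inner ℝ g ξ * Complex.I) := by
  have hT := (continuous_diagonalMap b a).measurable
  have : (ν.map fun x => g + diagonalMap b a x) = (ν.map (diagonalMap b a)).map (g + ·) :=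
    (Measure.map_map (by fun_prop) hT).symm
  rw [this, charFun_map_const_add]
  congr 1
  rw [charFun_apply, charFun_apply, integral_map hT.aemeasurable (by fun_prop)]
  simp only [inner_diagonalMap_left]

/-- Diagonalisation of the covariance form. -/
lemma exists_orthonormalBasis_variance_eq {n : ℕ} (hn : Module.finrank ℝ E = n) {ν : Measure E}
    [IsProbabilityMeasure ν] (hν : MemLp id 2 ν) :
    ∃ (b : OrthonormalBasis (Fin n) ℝ E) (l : Fin n → ℝ),
      ∀ ξ, Var[fun x => inner ℝ ξ x; ν] = ∑ j, l j * inner ℝ (b j) ξ ^ 2 := by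
  set S := InnerProductSpace.continuousLinearMapOfBilin (covarianceBilin ν) with hS
  have hSin : ∀ x y, inner ℝ (S x) y = covarianceBilin ν x y := fun x y =>
    InnerProductSpace.continuousLinearMapOfBilin_apply _ x y
  have hsym : S.toLinearMap.IsSymmetric := fun x y => by
    rw [ContinuousLinearMap.coe_coe, hSin, real_inner_comm, hSin, covarianceBilin_comm]
  refine ⟨hsym.eigenvectorBasis hn, hsym.eigenvalues hn, fun ξ => ?_⟩
  rw [← covarianceBilin_self hν, ← hSin, ← (hsym.eigenvectorBasis hn).sum_inner_mul_inner]
  refine Finset.sum_congr rfl fun i _ => ?_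
  have h1 := hsym ξ (hsym.eigenvectorBasis hn i)
  rw [hsym.apply_eigenvectorBasis hn i] at h1
  rw [ContinuousLinearMap.coe_coe] at h1
  rw [h1, real_inner_smul_right, real_inner_comm]
  simp
  ring

/-- If all marginals of `ν₀` in unit directions have the same law `β`, and the marginals of `ν` in
a dense set of directions are affine images of `β`, then `ν` is an affine image of `ν₀`.
The centre and the width of a marginal are read off from its mean and variance, so they are
a linear form and the square root of a quadratic form in the direction; the diagonalisation of the
latter gives the affine map, and the characteristic functions agree. -/
lemma exists_eq_map_add_diagonalMap [Nontrivial E] {n : ℕ} (hn : Module.finrank ℝ E = n)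
    {ν ν₀ : Measure E} [IsProbabilityMeasure ν] [IsProbabilityMeasure ν₀] (hν : MemLp id 2 ν)
    {β : Measure ℝ} [IsProbabilityMeasure β] (hβ : MemLp id 2 β)
    (h₀ : ∀ ω : E, ‖ω‖ = 1 → (ν₀.map fun x => inner ℝ ω x) = β)
    (hpos : ∀ ω : E, ω ≠ 0 → 0 < Var[fun x => inner ℝ ω x; ν])
    (hdense : Dense {ω : Metric.sphere (0 : E) 1 | ∃ c r : ℝ, 0 < r ∧
      (ν.map fun x => inner ℝ (ω : E) x) = β.map fun s => c + r * s}) :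
    ∃ (g : E) (b : OrthonormalBasis (Fin n) ℝ E) (a : Fin n → ℝ), (∀ j, 0 < a j) ∧
      ν = ν₀.map fun x => g + diagonalMap b a x := by
  obtain ⟨b, l, hQ⟩ := exists_orthonormalBasis_variance_eq hn hν
  set g : E := ∫ x, x ∂ν with hg
  set v : ℝ := Var[id; β] with hv
  have hint : Integrable id ν := hν.integrable (by norm_num)
  have hintβ : Integrable (fun s : ℝ => s) β := hβ.integrable (by norm_num)
  have hmean : ∫ s, s ∂β = 0 := by
    obtain ⟨ω, hω⟩ := exists_norm_eq E (c := 1) zero_le_one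
    have hneg : β.map (fun s => -s) = β := by
      conv_rhs => rw [← h₀ (-ω) (by rwa [norm_neg])]
      rw [← h₀ ω hω, Measure.map_map (by fun_prop) (by fun_prop)]
      congr 1
      ext x
      simp
    have h1 : ∫ s, s ∂β = - ∫ s, s ∂β := by
      conv_lhs => rw [← hneg]
      rw [integral_map (by fun_prop) (by fun_prop), integral_neg]
    linarith
  -- The centre and the half-width of a marginal, in terms of the mean and the variance.
  have hpar : ∀ ω : E, ∀ c r : ℝ, (ν.map fun x => inner ℝ ω x) = β.map (fun s => c + r * s) →
      c = inner ℝ g ω ∧ Var[fun x => inner ℝ ω x; ν] = r ^ 2 * v := by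
    intro ω c r h
    constructor
    · have h1 : ∫ y, y ∂(ν.map fun x => inner ℝ ω x) = inner ℝ ω g := by
        rw [integral_map (by fun_prop) (by fun_prop)]
        exact integral_inner hint ω
      rw [h, integral_map (by fun_prop) (by fun_prop),
        integral_add (integrable_const _) (hintβ.const_mul r), integral_const_mul, hmean,
        real_inner_comm] at h1
      simpa using h1
    · have h1 : Var[id; ν.map fun x => inner ℝ ω x] = Var[fun x => inner ℝ ω x; ν] :=
        variance_map (by fun_prop) (by fun_prop)
      rw [← h1, h, variance_map (by fun_prop) (by fun_prop)]
      change Var[fun s => c + r * id s; β] = _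
      rw [variance_const_add (by fun_prop), variance_const_mul]
  have hvpos : 0 < v := by
    have : Nonempty (Metric.sphere (0 : E) 1) :=
      (NormedSpace.sphere_nonempty.2 zero_le_one).to_subtype
    obtain ⟨ω, c, r, hr, h⟩ := hdense.nonempty
    have hω0 : (ω : E) ≠ 0 := ne_zero_of_mem_unit_sphere ω
    have h1 := hpos ω hω0
    rw [(hpar ω c r h).2] at h1
    exact pos_of_mul_pos_right h1 (sq_nonneg r)
  have hl : ∀ j, 0 < l j := by
    intro j
    classical
    have h1 := hpos (b j) (b.orthonormal.ne_zero j)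
    rw [hQ] at h1
    simpa [b.inner_eq_ite] using h1
  set a : Fin n → ℝ := fun j => √(l j / v) with ha
  have hT : ∀ ξ, ‖diagonalMap b a ξ‖ ^ 2 * v = Var[fun x => inner ℝ ξ x; ν] := by
    intro ξ
    rw [norm_diagonalMap_sq, hQ, Finset.sum_mul]
    refine Finset.sum_congr rfl fun j _ => ?_
    rw [ha, Real.sq_sqrt (div_pos (hl j) hvpos).le]
    field_simp
  refine ⟨g, b, a, fun j => Real.sqrt_pos.2 (div_pos (hl j) hvpos), ?_⟩
  have hcont := continuous_diagonalMap b a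
  have hunit : ∀ η : E, η ≠ 0 → ‖‖η‖⁻¹ • η‖ = 1 := fun η hη => by
    rw [norm_smul, norm_inv, norm_norm, inv_mul_cancel₀ (norm_ne_zero_iff.2 hη)]
  have hradial : ∀ η : E, charFun ν₀ η = charFun β ‖η‖ := by
    intro η
    rcases eq_or_ne η 0 with rfl | hη
    · simp
    · have h1 : η = ‖η‖ • (‖η‖⁻¹ • η) := by
        rw [smul_smul, mul_inv_cancel₀ (norm_ne_zero_iff.2 hη), one_smul]
      conv_lhs => rw [h1]
      rw [charFun_smul_eq_charFun_map_inner, h₀ _ (hunit η hη)]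
  have hprob : IsProbabilityMeasure (ν₀.map fun x => g + diagonalMap b a x) :=
    Measure.isProbabilityMeasure_map (by fun_prop)
  refine Measure.ext_of_charFun (funext fun ξ => ?_)
  rw [charFun_map_add_diagonalMap, hradial]
  rcases eq_or_ne ξ 0 with rfl | hξ
  · have : diagonalMap b a 0 = 0 := by simp [diagonalMap]
    simp [this]
  -- Both sides are continuous along the sphere of radius `‖ξ‖`, and agree on a dense subset.
  have hfun : (fun ω : Metric.sphere (0 : E) 1 => charFun ν (‖ξ‖ • (ω : E))) =
      fun ω : Metric.sphere (0 : E) 1 => charFun β ‖diagonalMap b a (‖ξ‖ • (ω : E))‖ *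
        Complex.exp (inner ℝ g (‖ξ‖ • (ω : E)) * Complex.I) := by
    refine Continuous.ext_on hdense ?_ ?_ ?_
    · exact continuous_charFun.comp (by fun_prop)
    · exact (continuous_charFun.comp (by fun_prop)).mul (by fun_prop)
    · rintro ω ⟨c, r, hr, h⟩
      obtain ⟨hc, hvar⟩ := hpar ω c r h
      have hr' : ‖diagonalMap b a (‖ξ‖ • (ω : E))‖ = r * ‖ξ‖ := by
        have h1 : diagonalMap b a (‖ξ‖ • (ω : E)) = ‖ξ‖ • diagonalMap b a ω := by
          simp only [diagonalMap, real_inner_smul_right, Finset.smul_sum, smul_smul]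
          exact Finset.sum_congr rfl fun j _ => by congr 1; ring
        have h2 : ‖diagonalMap b a (ω : E)‖ = r := by
          rw [← hT] at hvar
          exact (sq_eq_sq₀ (norm_nonneg _) hr.le).1 (mul_right_cancel₀ hvpos.ne' hvar)
        rw [h1, norm_smul, h2, norm_norm, mul_comm]
      have hmap : (β.map fun s => c + r * s) = (β.map (r * ·)).map (c + ·) :=
        (Measure.map_map (by fun_prop) (by fun_prop)).symm
      change charFun ν (‖ξ‖ • (ω : E)) = _
      rw [charFun_smul_eq_charFun_map_inner, h, hmap, charFun_map_const_add, charFun_map_mul]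
      simp only
      rw [hr', real_inner_smul_right, ← hc]
      simp
  have h1 : ‖ξ‖ • (‖ξ‖⁻¹ • ξ) = ξ := by
    rw [smul_smul, mul_inv_cancel₀ (norm_ne_zero_iff.2 hξ), one_smul]
  have h2 := congrFun hfun ⟨‖ξ‖⁻¹ • ξ, mem_sphere_zero_iff_norm.2 (hunit ξ hξ)⟩
  simpa only [h1] using h2

end

/-! ### From equality of measures to equality of domains -/

section

variable {E : Type*} [NormedAddCommGroup E] [InnerProductSpace ℝ E]

lemma diagonalMap_diagonalMap_of_mul_eq_one {n : ℕ} (b : OrthonormalBasis (Fin n) ℝ E)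
    {a a' : Fin n → ℝ} (h : ∀ j, a j * a' j = 1) (x : E) :
    diagonalMap b a (diagonalMap b a' x) = x := by
  conv_rhs => rw [← b.sum_repr' x]
  rw [diagonalMap]
  refine Finset.sum_congr rfl fun j _ => ?_
  rw [inner_diagonalMap, ← mul_assoc, h, one_mul]

/-- The affine homeomorphism that carries the unit ball to the ellipsoid with centre `g`, axes `b`
and semi-axes `a`. -/
noncomputable def ellipsoidHomeomorph {n : ℕ} (g : E) (b : OrthonormalBasis (Fin n) ℝ E)
    (a : Fin n → ℝ) (ha : ∀ j, 0 < a j) : E ≃ₜ E where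
  toFun x := g + diagonalMap b a x
  invFun x := diagonalMap b (fun j => (a j)⁻¹) (x - g)
  left_inv x := by
    simp only [add_sub_cancel_left]
    exact diagonalMap_diagonalMap_of_mul_eq_one b (fun j => inv_mul_cancel₀ (ha j).ne') x
  right_inv x := by
    simp [diagonalMap_diagonalMap_of_mul_eq_one b (fun j => mul_inv_cancel₀ (ha j).ne')]
  continuous_toFun := continuous_const.add (continuous_diagonalMap b a)
  continuous_invFun := (continuous_diagonalMap b _).comp (continuous_id.sub continuous_const)

lemma ellipsoidHomeomorph_symm_preimage_ball {n : ℕ} (g : E) (b : OrthonormalBasis (Fin n) ℝ E)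
    (a : Fin n → ℝ) (ha : ∀ j, 0 < a j) :
    (ellipsoidHomeomorph g b a ha).symm ⁻¹' Metric.ball 0 1 =
      {x | ∑ j, (inner ℝ (b j) (x - g) / a j) ^ 2 < 1} := by
  ext x
  have h : (ellipsoidHomeomorph g b a ha).symm x = diagonalMap b (fun j => (a j)⁻¹) (x - g) := rfl
  rw [mem_preimage, mem_ball_zero_iff, ← sq_lt_one_iff₀ (norm_nonneg _), h, norm_diagonalMap_sq,
    mem_ofPred_eq]
  simp only [← mul_pow, inv_mul_eq_div]

variable [FiniteDimensional ℝ E] [MeasurableSpace E] [BorelSpace E]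

lemma cond_volume_eq_zero_iff {D U : Set E} (hDo : IsOpen D) (hbd : Bornology.IsBounded D)
    (hU : IsOpen U) :
    ProbabilityTheory.cond (volume : Measure E) D U = 0 ↔ D ∩ U = ∅ := by
  rw [ProbabilityTheory.cond_apply hDo.measurableSet, mul_eq_zero, ENNReal.inv_eq_zero,
    (hDo.inter hU).measure_eq_zero_iff volume]
  exact or_iff_right hbd.measure_lt_top.ne

/-- If the uniform distribution on `D` is the image of the one on the unit ball under a
homeomorphism, then `D` and the image of the ball agree up to boundary points. -/
lemma subset_and_subset_closure_of_cond_eq_map {D : Set E} (hDo : IsOpen D)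
    (hbd : Bornology.IsBounded D) (e : E ≃ₜ E)
    (h : ProbabilityTheory.cond (volume : Measure E) D =
      (ProbabilityTheory.cond (volume : Measure E) (Metric.ball 0 1)).map e) :
    D ⊆ e.symm ⁻¹' Metric.ball 0 1 ∧ e.symm ⁻¹' Metric.ball 0 1 ⊆ closure D := by
  have key : ∀ U : Set E, IsOpen U → (D ∩ U = ∅ ↔ Metric.ball 0 1 ∩ e ⁻¹' U = ∅) := by
    intro U hU
    rw [← cond_volume_eq_zero_iff hDo hbd hU, h,
      Measure.map_apply e.measurable hU.measurableSet,
      cond_volume_eq_zero_iff Metric.isOpen_ball Metric.isBounded_ball (hU.preimage e.continuous)]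
  constructor
  · have h1 : D ⊆ e.symm ⁻¹' Metric.closedBall 0 1 := by
      have h2 := (key (e.symm ⁻¹' (Metric.closedBall 0 1)ᶜ)
        (Metric.isClosed_closedBall.isOpen_compl.preimage e.symm.continuous)).2 (by
          ext x
          simp only [mem_inter_iff, mem_preimage, Homeomorph.symm_apply_apply, mem_compl_iff,
            mem_empty_iff_false, iff_false, not_and, not_not]
          exact fun hx => Metric.ball_subset_closedBall hx)
      intro x hx
      by_contra hcon
      exact (h2 ▸ (⟨hx, hcon⟩ : x ∈ D ∩ e.symm ⁻¹' (Metric.closedBall 0 1)ᶜ) : x ∈ (∅ : Set E))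
    have h3 := interior_maximal h1 hDo
    rwa [← e.symm.preimage_interior, interior_closedBall _ one_ne_zero] at h3
  · have h2 := (key (closure D)ᶜ isClosed_closure.isOpen_compl).1
      (disjoint_compl_right.mono_left subset_closure).inter_eq
    intro x hx
    by_contra hcon
    exact (h2 ▸ (⟨hx, by simpa using hcon⟩ :
      e.symm x ∈ Metric.ball 0 1 ∩ e ⁻¹' (closure D)ᶜ) : e.symm x ∈ (∅ : Set E))

end

/-- A domain with smooth boundary has no boundary points interior to its closure: a defining
function has no local maximum, so it takes positive values near every boundary point. -/
lemma interior_closure_subset_of_hasSmoothBoundary {n : ℕ} {D : Set (EuclideanSpace ℝ (Fin n))}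
    (hDo : IsOpen D) (hs : HasSmoothBoundary D) : interior (closure D) ⊆ D := by
  intro p hp
  by_contra hpD
  have hfr : p ∈ frontier D := by
    rw [hDo.frontier_eq]
    exact ⟨interior_subset hp, hpD⟩
  obtain ⟨U, hU, hpU, ρ, hρ, hd, hDU⟩ := hs p hfr
  have hmem : ∀ x ∈ U, x ∈ D ↔ ρ x < 0 := fun x hx => by
    have := Set.ext_iff.1 hDU x
    simpa [hx] using this
  have hρp : 0 ≤ ρ p := not_lt.1 fun h => hpD ((hmem p hpU).2 h)
  refine hd p hpU (IsLocalMax.fderiv_eq_zero ?_)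
  filter_upwards [hU.mem_nhds hpU, isOpen_interior.mem_nhds hp] with q hqU hq
  refine le_trans ?_ hρp
  by_contra! hcon
  have hnear : ∀ᶠ y in 𝓝 q, 0 < ρ y :=
    (hρ.continuousOn.continuousAt (hU.mem_nhds hqU)).eventually_const_lt hcon
  obtain ⟨V, hV, hVo, hqV⟩ := mem_nhds_iff.1 (hnear.and (hU.mem_nhds hqU))
  obtain ⟨y, hyV, hyD⟩ := mem_closure_iff.1 (interior_subset hq) V hVo hqV
  exact absurd ((hmem y (hV hyV).2).1 hyD) (not_lt.2 (hV hyV).1.le)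

theorem theoremT (n : ℕ) (hn : Odd n) (D : Set (EuclideanSpace ℝ (Fin n)))
    (hD : IsDomainSet D) (hbdd : Bornology.IsBounded D) (hsmooth : HasSmoothBoundary D)
    (hpoly : ∀ᵐ ω ∂(volume : Measure (EuclideanSpace ℝ (Fin n))).toSphere,
      ∃ p : Polynomial ℝ, p.natDegree ≤ n - 1 ∧
        ∀ t : ℝ, (D ∩ hyperplane ω t).Nonempty → sectionVolume D ω t = p.eval t) :
    IsEllipsoid D := by
  obtain ⟨m, rfl⟩ := hn
  obtain ⟨hDo, hDc⟩ := hD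
  have hne := hDc.nonempty
  have hfr : Module.finrank ℝ (EuclideanSpace ℝ (Fin (2 * m + 1))) = 2 * m + 1 :=
    finrank_euclideanSpace_fin
  have : Nontrivial (EuclideanSpace ℝ (Fin (2 * m + 1))) :=
    Module.nontrivial_of_finrank_pos (R := ℝ) (by omega)
  have := isProbabilityMeasure_cond_volume hDo hne hbdd
  have hball : (Metric.ball (0 : EuclideanSpace ℝ (Fin (2 * m + 1))) 1).Nonempty :=
    Metric.nonempty_ball.2 one_pos
  have hν₀ := isProbabilityMeasure_cond_volume Metric.isOpen_ball hball Metric.isBounded_ball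
  have hL₀ := memLp_id_cond_volume Metric.isOpen_ball hball Metric.isBounded_ball
  obtain ⟨ω₀, hω₀⟩ := exists_norm_eq (EuclideanSpace ℝ (Fin (2 * m + 1))) (c := 1) zero_le_one
  have hβ : IsProbabilityMeasure (bumpMeasure m) := by
    rw [← map_inner_cond_ball hω₀ hfr]
    exact Measure.isProbabilityMeasure_map (by fun_prop)
  have hLβ : MemLp id 2 (bumpMeasure m) := by
    rw [← map_inner_cond_ball hω₀ hfr, memLp_map_measure_iff (by fun_prop) (by fun_prop)]
    exact hL₀.const_inner ω₀
  have hdense : Dense {ω : Metric.sphere (0 : EuclideanSpace ℝ (Fin (2 * m + 1))) 1 |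
      ∃ c r : ℝ, 0 < r ∧ ((ProbabilityTheory.cond volume D).map fun x =>
        inner ℝ (ω : EuclideanSpace ℝ (Fin (2 * m + 1))) x) =
          (bumpMeasure m).map fun s => c + r * s} := by
    refine Measure.dense_of_ae
      (μ := (volume : Measure (EuclideanSpace ℝ (Fin (2 * m + 1)))).toSphere) ?_
    filter_upwards [hpoly, ae_toSphere_hasParabolicSupport hne hbdd] with ω ⟨p, hdeg, hp⟩ ⟨h1, h2⟩
    have hω : ‖(ω : EuclideanSpace ℝ (Fin (2 * m + 1)))‖ = 1 := norm_eq_of_mem_sphere ω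
    obtain ⟨a, b, A, hab, hA⟩ := exists_section_volume_eq_bumpDensity hω hfr hDo hDc h1 h2 hdeg
      (fun t ht => by rw [hfr]; exact hp t ht)
    exact ⟨(a + b) / 2, (b - a) / 2, by linarith,
      map_inner_cond_eq_map_bumpMeasure hω hDo hne hbdd hab hA⟩
  obtain ⟨g, b, a, ha, hmap⟩ := exists_eq_map_add_diagonalMap hfr
    (memLp_id_cond_volume hDo hne hbdd) hLβ (fun ω hω => map_inner_cond_ball hω hfr)
    (fun ω hω => variance_inner_cond_pos hω hDo hne hbdd) hdense
  obtain ⟨h1, h2⟩ := subset_and_subset_closure_of_cond_eq_map hDo hbdd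
    (ellipsoidHomeomorph g b a ha) hmap
  have h3 := (interior_maximal h2 (Metric.isOpen_ball.preimage (Homeomorph.continuous _))).trans
    (interior_closure_subset_of_hasSmoothBoundary hDo hsmooth)
  exact ⟨g, b, a, ha, by rw [← ellipsoidHomeomorph_symm_preimage_ball]; exact h1.antisymm h3⟩
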